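/- Let $k$ be a field, $p,m\ge 0$, $x=(x_1,\dots,x_p)$, $y=(y_1,\dots,y_m)$, and let $I\subset k[x,y]$ be a binomial ideal, i.e. $I$ is generated by binomials $z^{\gamma^+}-z^{\gamma^-}$ ($z=(x,y)$, $\gamma\in\mathbb Z^{p+m}$, with positive and negative parts $\gamma^{\pm}$), $k[x,y]/I$ has no nonzero nilpotents, and $z_if\in I$ implies $f\in I$ for every variable $z_i$ and every $f\in k[x,y]$. Assume that $V(I)\subset\mathbb A^p\times\mathbb A^m$ meets $\{0\}\times\mathbb T^m$. Let $A=k[y^{\pm}]$ be the ring of Laurent polynomials, and regard $I$ as an ideal of $A[x]=k[x,y^{\pm}]$. Let $J\subset A$ be the ideal generated by all $1-y^\gamma\in I$ ($\gamma\in\mathbb Z^m$), let $B=A/J$, write $f\mapsto f_J$ for the reduction $A[x]\to B[x]$, and let $I_J\subset B[x]$ be the image of $I$. Order $\mathbb N^p$ totally by the lexicographic order of $(|\alpha|,\alpha_1,\dots,\alpha_p)$. For a nonzero formal power series $F$ in $x$, $\exp F$ is the smallest element of $\operatorname{supp}F$. Let $\mathfrak N(I_J)=\{\exp F: 0\ne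 F\in I_J\cdot B[[x]]\}$, and let $\alpha^1,\dots,\alpha^s$ (in any order, without repetition) be its vertices, i.e. the elements of the smallest finite set $V\subset\mathbb N^p$ with $\mathfrak N(I_J)=V+\mathbb N^p$. Put $\Delta_i=(\alpha^i+\mathbb N^p)\setminus\bigcup_{1\le j<i}\Delta_j$ for $1\le i\le s$, and $\Delta_0=\mathbb N^p\setminus\bigcup_{i=1}^s\Delta_i$. (0) For each $i$ there is a binomial $G^i=x^{\alpha^i}-x^{\eta^i}y^{\zeta^i}\in I$ (as an ideal of $A[x]$) with $\eta^i\in\mathbb N^p$, $\alpha^i<\eta^i$, $\zeta^i\in\mathbb Z^m$ and $\exp G^i_J=\alpha^i$. For every choice of binomials $G^i$ as in (0): (1) For each $F\in A[x]$ there are unique $Q_1,\dots,Q_s,R\in A[x]$ such that $\alpha^i+\operatorname{supp}Q_i\subset\Delta_i$ ($i=1,\dots,s$), $\operatorname{supp}R\subset\Delta_0$, and $$F=\sum_{i=1}^sG^iQ_i+R.$$ (2) If $F=c\,x^\delta y^\gamma$ with $c\in k$, $\delta\in\mathbb N^p$, $\gamma\in\mathbb Z^m$, then the remainder in (1) is $R=c\,x^{\delta'}y^{\gamma'}$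 for some $\delta'\in\mathbb N^p$, $\gamma'\in\mathbb Z^m$. Moreover: (3) For each $i=1,\dots,s$ there is a binomial $F^i=x^{\alpha^i}-x^{\beta^i}y^{\gamma^i}\in I$ with $\beta^i\in\mathbb N^p\setminus\mathfrak N(I_J)$, $\alpha^i<\beta^i$, $\gamma^i\in\mathbb Z^m$. It is unique modulo $J\cdot A[x]$: any two such binomials, for the same $i$, have the same $\beta^i$ and differ by an element of $J\cdot A[x]$. Any such $F^1,\dots,F^s$ generate $I$ modulo $J\cdot A[x]$: $I\cdot A[x]=(F^1,\dots,F^s)+J\cdot A[x]$. -/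

import Mathlib

open MvPolynomial

noncomputable section

namespace BinomialStd

/-- `I ⊆ k[x_i : i ∈ σ]` is a *binomial ideal*: it is generated by binomials `x^{γ⁺} - x^{γ⁻}`
with `γ ∈ ℤ^σ`, the quotient ring has no nilpotents, and no variable is a zero divisor
modulo `I`. -/
structure IsBinomialIdeal {σ k : Type*} [Fintype σ] [Field k]
    (I : Ideal (MvPolynomial σ k)) : Prop where
  generated : ∃ S : Set (σ → ℤ), I = Ideal.span ((fun γ : σ → ℤ =>
    (∏ i, (X i : MvPolynomial σ k) ^ (γ i).toNat) - ∏ i, X i ^ (-γ i).toNat) '' S)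
  reduced : IsReduced (MvPolynomial σ k ⧸ I)
  saturated : ∀ (i : σ) (f : MvPolynomial σ k), X i * f ∈ I → f ∈ I

/-- `V(I) ⊆ 𝔸^p × 𝔸^m` meets `{0} × 𝕋^m`. The variables `x` are indexed by `Fin p`, the
variables `y` by `Fin m`. (A closed subscheme of a scheme of finite type over `k` is nonempty
iff it has a point over the algebraic closure.) -/
def MeetsZeroTorus {k : Type*} [Field k] {p m : ℕ}
    (I : Ideal (MvPolynomial (Fin p ⊕ Fin m) k)) : Prop :=
  ∃ t : Fin m → AlgebraicClosure k, (∀ j, t j ≠ 0) ∧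
    ∀ f ∈ I, aeval (Sum.elim (fun _ : Fin p => (0 : AlgebraicClosure k)) t) f = 0

/-- The ring `A = k[y^±]` of Laurent polynomials in `m` variables. -/
abbrev Laurent (k : Type*) [Field k] (m : ℕ) : Type _ := AddMonoidAlgebra k (Fin m → ℤ)

/-- The Laurent monomial `y^γ`. -/
def yMon (k : Type*) [Field k] {m : ℕ} (γ : Fin m → ℤ) : Laurent k m :=
  AddMonoidAlgebra.single γ 1

/-- The binomial `x^α - x^β y^γ` in `A[x]`. -/
def binom (k : Type*) [Field k] {p m : ℕ} (α β : Fin p →₀ ℕ) (γ : Fin m → ℤ) :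
    MvPolynomial (Fin p) (Laurent k m) :=
  monomial α 1 - monomial β (yMon k γ)

/-- The inclusion `k[x, y] → k[x, y^±] = A[x]`. -/
def toLaurent (k : Type*) [Field k] (p m : ℕ) :
    MvPolynomial (Fin p ⊕ Fin m) k →ₐ[k] MvPolynomial (Fin p) (Laurent k m) :=
  aeval (Sum.elim (fun i => X i) (fun j => C (yMon k (Pi.single j 1))))

section Ideals

variable {k : Type*} [Field k] {p m : ℕ} (I : Ideal (MvPolynomial (Fin p ⊕ Fin m) k))

/-- `I` considered as an ideal of `A[x] = k[x, y^±]`. -/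
def extIdeal : Ideal (MvPolynomial (Fin p) (Laurent k m)) :=
  I.map (toLaurent k p m)

/-- The ideal `J ⊆ k[y^±]` generated by all binomials `1 - y^γ` that belong to `I`. -/
def yIdeal : Ideal (Laurent k m) :=
  Ideal.span {h | ∃ γ : Fin m → ℤ, h = 1 - yMon k γ ∧ C h ∈ extIdeal I}

/-- `J · A[x]`. -/
def yIdealExt : Ideal (MvPolynomial (Fin p) (Laurent k m)) :=
  (yIdeal I).map C

/-- The reduction `f ↦ f_J` from `A[x]` to `B[x]`, where `B = A / J`. -/
def modJ : MvPolynomial (Fin p) (Laurent k m) →+*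
    MvPolynomial (Fin p) (Laurent k m ⧸ yIdeal I) :=
  MvPolynomial.map (Ideal.Quotient.mk (yIdeal I))

/-- The ideal `I_J · B⟦x⟧`, where `I_J ⊆ B[x]` is the ideal induced by `I`. -/
def formalIdeal : Ideal (MvPowerSeries (Fin p) (Laurent k m ⧸ yIdeal I)) :=
  ((extIdeal I).map (modJ I)).map MvPolynomial.coeToMvPowerSeries.ringHom

end Ideals

/-- `α` is the initial exponent of `F`: the smallest element of the support of `F`, for the
lexicographic ordering of the tuples `(|α|, α₁, …, α_q)`, which is Mathlib's `DegLex` order. -/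
def IsInitialExponent {R : Type*} [CommRing R] {q : ℕ} (F : MvPowerSeries (Fin q) R)
    (α : Fin q →₀ ℕ) : Prop :=
  MvPowerSeries.coeff α F ≠ 0 ∧
    ∀ β, MvPowerSeries.coeff β F ≠ 0 → toDegLex α ≤ toDegLex β

/-- The diagram of initial exponents of an ideal of `R⟦x⟧`: the initial exponents of its
nonzero elements. -/
def diagram {R : Type*} [CommRing R] {q : ℕ} (K : Ideal (MvPowerSeries (Fin q) R)) :
    Set (Fin q →₀ ℕ) :=
  {α | ∃ F ∈ K, F ≠ 0 ∧ IsInitialExponent F α}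

theorem diagram_add {R : Type*} [CommRing R] {q : ℕ} (K : Ideal (MvPowerSeries (Fin q) R)) :
    ∀ α ∈ diagram K, ∀ ε, α + ε ∈ diagram K := by
  rintro α ⟨F, hF, -, h1, h2⟩ ε
  have h3 : MvPowerSeries.coeff (α + ε) (F * MvPowerSeries.monomial ε 1) ≠ 0 := by
    rw [MvPowerSeries.coeff_add_mul_monomial, mul_one]
    exact h1
  refine ⟨F * MvPowerSeries.monomial ε 1, K.mul_mem_right _ hF, fun h => ?_, h3, ?_⟩
  · rw [h] at h3
    exact h3 (map_zero _)
  · intro β hβ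
    rw [MvPowerSeries.coeff_mul_monomial] at hβ
    split_ifs at hβ with hε
    · rw [mul_one] at hβ
      have h4 : toDegLex (α + ε) ≤ toDegLex (β - ε + ε) := by
        rw [toDegLex_add, toDegLex_add]
        exact add_le_add_left (h2 _ hβ) _
      rwa [tsub_add_cancel_of_le hε] at h4
    · exact absurd rfl hβ

/-- The vertices of `N ⊆ ℕ^q`: its minimal elements for the componentwise order. By
`vertices_isLeast`, if `N + ℕ^q = N` (see `diagram_add`) then this is the smallest finite set `V` with
`N = V + ℕ^q`. -/
def vertices {q : ℕ} (N : Set (Fin q →₀ ℕ)) : Set (Fin q →₀ ℕ) :=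
  {α | Minimal (· ∈ N) α}

theorem vertices_finite {q : ℕ} (N : Set (Fin q →₀ ℕ)) : (vertices N).Finite :=
  WellQuasiOrderedLE.finite_of_isAntichain (setOfPred_minimal_antichain (· ∈ N))

theorem vertices_isLeast {q : ℕ} (N : Set (Fin q →₀ ℕ)) (hN : ∀ α ∈ N, ∀ ε, α + ε ∈ N) :
    IsLeast {V : Set (Fin q →₀ ℕ) | V.Finite ∧ N = {δ | ∃ v ∈ V, ∃ ε, δ = v + ε}}
      (vertices N) := by
  refine ⟨⟨vertices_finite N, ?_⟩, ?_⟩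
  · ext δ
    constructor
    · intro h
      obtain ⟨v, hv, hm⟩ := exists_minimal_le_of_wellFoundedLT (· ∈ N) δ h
      exact ⟨v, hm, δ - v, (add_tsub_cancel_of_le hv).symm⟩
    · rintro ⟨v, hv, ε, rfl⟩
      exact hN v hv.1 ε
  · rintro V ⟨_, hV⟩ α hα
    have h1 : α ∈ {δ | ∃ v ∈ V, ∃ ε, δ = v + ε} := hV ▸ hα.1
    obtain ⟨v, hv, ε, rfl⟩ := h1
    have h2 : v ∈ N := by
      rw [hV]
      exact ⟨v, hv, 0, by simp⟩
    have h3 : v + ε = v := le_antisymm (hα.2 h2 le_self_add) le_self_add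
    rw [h3]
    exact hv

/-- The set `Δ_i` of the partition of `ℕ^q` attached to `α^1, …, α^s`. -/
def Δ {q s : ℕ} (α : Fin s → Fin q →₀ ℕ) (i : Fin s) : Set (Fin q →₀ ℕ) :=
  {δ | α i ≤ δ ∧ ∀ j < i, ¬ α j ≤ δ}

/-- `Δ_i = (α^i + ℕ^q) \ ⋃_{j < i} Δ_j`. -/
theorem Δ_eq {q s : ℕ} (α : Fin s → Fin q →₀ ℕ) (i : Fin s) :
    Δ α i = {δ | ∃ ε, δ = α i + ε} \ ⋃ j, ⋃ (_ : j < i), Δ α j := by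
  ext δ
  simp only [Set.mem_sdiff, Set.mem_ofPred_eq, Set.mem_iUnion, not_exists]
  constructor
  · rintro ⟨h1, h2⟩
    exact ⟨⟨δ - α i, (add_tsub_cancel_of_le h1).symm⟩, fun j hj h => h2 j hj h.1⟩
  · rintro ⟨⟨ε, rfl⟩, h2⟩
    refine ⟨le_self_add, fun j => ?_⟩
    induction j using WellFoundedLT.induction with
    | ind j ih =>
      intro hj h
      exact h2 j hj ⟨h, fun l hl => ih l hl (hl.trans hj)⟩

/-- `Δ_0 = ℕ^q \ ⋃_i Δ_i`. -/
def Δ₀ {q s : ℕ} (α : Fin s → Fin q →₀ ℕ) : Set (Fin q →₀ ℕ) :=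
  {δ | ∀ i, δ ∉ Δ α i}

/-- `F = ∑ G^i Q_i + R` is a Hironaka division with respect to `α^1, …, α^s`:
`α^i + supp Q_i ⊆ Δ_i` and `supp R ⊆ Δ_0`. -/
structure IsDivision {A : Type*} [CommRing A] {q s : ℕ} (α : Fin s → Fin q →₀ ℕ)
    (G : Fin s → MvPolynomial (Fin q) A) (F : MvPolynomial (Fin q) A)
    (Q : Fin s → MvPolynomial (Fin q) A) (R : MvPolynomial (Fin q) A) : Prop where
  supp_quotient : ∀ i, ∀ ε ∈ (Q i).support, α i + ε ∈ Δ α i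
  supp_remainder : ∀ δ ∈ R.support, δ ∈ Δ₀ α
  eq : F = ∑ i, G i * Q i + R

section Representatives

variable {k : Type*} [Field k] {p m : ℕ} (I : Ideal (MvPolynomial (Fin p ⊕ Fin m) k))

/-- The binomial `G = x^α - x^β y^γ` belongs to `I`, with `α < β`, and represents `α`:
`exp G_J = α`. -/
structure Represents (α β : Fin p →₀ ℕ) (γ : Fin m → ℤ) : Prop where
  mem : binom k α β γ ∈ extIdeal I
  lt : toDegLex α < toDegLex β
  exp : IsInitialExponent (modJ I (binom k α β γ)).toMvPowerSeries α

/-- `F = x^α - x^β y^γ` is a binomial in `I` with `β ∉ 𝔑(I_J)` and `α < β`. -/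
structure IsStdBinomial (α β : Fin p →₀ ℕ) (γ : Fin m → ℤ) : Prop where
  mem : binom k α β γ ∈ extIdeal I
  notMem_diagram : β ∉ diagram (formalIdeal I)
  lt : toDegLex α < toDegLex β

end Representatives

end BinomialStd

end

open MvPolynomial

noncomputable section

namespace BinomialStd

/-! ### Laurent monomials in `y` -/

section LaurentMonomials

variable {k : Type*} [Field k] {p m : ℕ}

/-! Write `E` for `extIdeal I`. Modulo `E` each `x^δ` is rewritten to a Laurent monomial `x^δ' y^γ`
with `δ < δ'`, as long as one exists. Although exponents grow, this stops (`wellFounded_reduction`):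
by Dickson's lemma an infinite chain contains `δ ≤ δ + ε` with `ε ≠ 0`, and cancelling `x^δ` by
saturation leaves `1 - x^ε y^γ ∈ E`, which takes the value 1 at a point of `{0} × 𝕋^m`. So normal
forms exist. The exponent is unique, and `y^γ` is unique modulo `J`.

As `E` is spanned by differences of Laurent monomials, passing to normal forms defines an `A`-linear
map `A[x] → B[x]` that kills `E` (`exists_normalFormMap`). It never lowers exponents, so an element
of `E` whose coefficients below an irreducible `α` lie in `J` has its coefficient at `α` in `J`
(`coeff_mem_yIdeal`). Truncating power series then identifies the diagram with the set of reducible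
exponents (`diagram_formalIdeal`).

Division by the `G^i` is a special case of the rewriting, so it terminates and takes monomials to
monomials. Uniqueness is a comparison of lowest terms. The remainder of an element of `E` has only
irreducible exponents, so it lies in `J · A[x]`, which gives the generators. -/

@[simp]
theorem yMon_zero : yMon k (0 : Fin m → ℤ) = 1 := rfl

theorem yMon_add (γ γ' : Fin m → ℤ) : yMon k (γ + γ') = yMon k γ * yMon k γ' := by
  simp [yMon, AddMonoidAlgebra.single_mul_single]

theorem yMon_mul_neg (γ : Fin m → ℤ) : yMon k γ * yMon k (-γ) = 1 := by
  rw [← yMon_add, add_neg_cancel, yMon_zero]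

theorem yMon_neg_mul (γ : Fin m → ℤ) : yMon k (-γ) * yMon k γ = 1 := by
  rw [← yMon_add, neg_add_cancel, yMon_zero]

theorem isUnit_yMon (γ : Fin m → ℤ) : IsUnit (yMon k γ) :=
  .of_mul_eq_one _ (yMon_mul_neg γ)

theorem yMon_sum {ι : Type*} (s : Finset ι) (γ : ι → Fin m → ℤ) :
    yMon k (∑ i ∈ s, γ i) = ∏ i ∈ s, yMon k (γ i) := by
  classical
  induction s using Finset.induction_on with
  | empty => simp
  | insert a s ha ih => rw [Finset.sum_insert ha, Finset.prod_insert ha, yMon_add, ih]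

theorem yMon_nsmul (n : ℕ) (γ : Fin m → ℤ) : yMon k (n • γ) = yMon k γ ^ n := by
  induction n with
  | zero => simp
  | succ n ih => rw [succ_nsmul, yMon_add, ih, pow_succ]

theorem yMon_eq_prod (n : Fin m → ℕ) :
    yMon k (fun j => (n j : ℤ)) = ∏ j, yMon k (Pi.single j 1) ^ n j := by
  simp_rw [← yMon_nsmul]
  rw [← yMon_sum]
  congr 1
  ext j
  simp [Finset.sum_apply, Pi.single_apply]

end LaurentMonomials

/-! ### Binomials as congruences between monomials -/

section BinomialAlgebra

variable {k : Type*} [Field k] {p m : ℕ}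

@[simp]
theorem binom_self (δ : Fin p →₀ ℕ) : binom k δ δ (0 : Fin m → ℤ) = 0 := by
  simp [binom]

theorem binom_swap (δ δ' : Fin p →₀ ℕ) (γ : Fin m → ℤ) :
    binom k δ' δ (-γ) = C (-yMon k (-γ)) * binom k δ δ' γ := by
  rw [binom, binom, mul_sub, C_mul_monomial, C_mul_monomial, neg_mul, neg_mul,
    yMon_neg_mul, mul_one, map_neg, map_neg]
  abel

theorem binom_trans (δ δ' δ'' : Fin p →₀ ℕ) (γ γ' : Fin m → ℤ) :
    binom k δ δ'' (γ + γ') = binom k δ δ' γ + C (yMon k γ) * binom k δ' δ'' γ' := by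
  simp [binom, mul_sub, C_mul_monomial, yMon_add]

theorem binom_add (ε δ δ' : Fin p →₀ ℕ) (γ : Fin m → ℤ) :
    binom k (ε + δ) (ε + δ') γ = monomial ε 1 * binom k δ δ' γ := by
  simp [binom, mul_sub, monomial_mul]

theorem binom_zero_zero (γ : Fin m → ℤ) :
    binom k (0 : Fin p →₀ ℕ) 0 γ = C (1 - yMon k γ) := by
  rw [map_sub, C_apply, C_apply, binom]

variable {E : Ideal (MvPolynomial (Fin p) (Laurent k m))}

/-- Membership in `E` is read as a congruence `x^δ ≡ x^δ' y^γ`. It can be inverted because `y^γ` is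
a unit. -/
theorem binom_mem_symm {δ δ' : Fin p →₀ ℕ} {γ : Fin m → ℤ} (h : binom k δ δ' γ ∈ E) :
    binom k δ' δ (-γ) ∈ E := by
  rw [binom_swap]
  exact E.mul_mem_left _ h

theorem binom_mem_trans {δ δ' δ'' : Fin p →₀ ℕ} {γ γ' : Fin m → ℤ} (h : binom k δ δ' γ ∈ E)
    (h' : binom k δ' δ'' γ' ∈ E) : binom k δ δ'' (γ + γ') ∈ E := by
  rw [binom_trans]
  exact E.add_mem h (E.mul_mem_left _ h')

theorem binom_mem_add {δ δ' : Fin p →₀ ℕ} {γ : Fin m → ℤ} (ε : Fin p →₀ ℕ) (h : binom k δ δ' γ ∈ E) :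
    binom k (ε + δ) (ε + δ') γ ∈ E := by
  rw [binom_add]
  exact E.mul_mem_left _ h

theorem mem_of_monomial_mul_mem (hE : ∀ i f, X i * f ∈ E → f ∈ E) (ε : Fin p →₀ ℕ)
    {f : MvPolynomial (Fin p) (Laurent k m)} (h : monomial ε 1 * f ∈ E) : f ∈ E := by
  induction ε using Finsupp.induction_linear generalizing f with
  | zero => simpa using h
  | add a b ha hb =>
    refine hb (ha ?_)
    rwa [← mul_assoc, monomial_mul, one_mul]
  | single i n =>
    induction n generalizing f with
    | zero => simpa using h
    | succ n ih =>
      refine hE i _ (ih ?_)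
      rwa [← mul_assoc, X, monomial_mul, one_mul, ← Finsupp.single_add]

theorem binom_mem_cancel (hE : ∀ i f, X i * f ∈ E → f ∈ E) {ε δ δ' : Fin p →₀ ℕ} {γ : Fin m → ℤ}
    (h : binom k (ε + δ) (ε + δ') γ ∈ E) : binom k δ δ' γ ∈ E := by
  rw [binom_add] at h
  exact mem_of_monomial_mul_mem hE ε h

end BinomialAlgebra

/-! ### Passing from `k[x, y]` to `k[x, y^±]` -/

section Extension

variable {k : Type*} [Field k] {p m : ℕ}

/-- The monomial `y^n` of `k[x, y]`. -/
def yPow (k : Type*) [Field k] (p : ℕ) {m : ℕ} (n : Fin m → ℕ) :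
    MvPolynomial (Fin p ⊕ Fin m) k :=
  ∏ j, X (Sum.inr j) ^ n j

theorem yPow_add (n n' : Fin m → ℕ) : yPow k p (n + n') = yPow k p n * yPow k p n' := by
  simp [yPow, pow_add, Finset.prod_mul_distrib]

theorem toLaurent_yPow (n : Fin m → ℕ) :
    toLaurent k p m (yPow k p n) = C (yMon k fun j => (n j : ℤ)) := by
  simp [yPow, toLaurent, yMon_eq_prod]

theorem isUnit_toLaurent_yPow (n : Fin m → ℕ) : IsUnit (toLaurent k p m (yPow k p n)) := by
  rw [toLaurent_yPow]
  exact (isUnit_yMon _).map C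

theorem exists_injective_algHom_laurent :
    ∃ ψ : MvPolynomial (Fin m) k →ₐ[k] Laurent k m, Function.Injective ψ ∧
      ∀ j, ψ (X j) = yMon k (Pi.single j 1) := by
  let c : (Fin m →₀ ℕ) →+ (Fin m → ℤ) :=
    { toFun := fun n j => (n j : ℤ)
      map_zero' := by ext; simp
      map_add' := by intros; ext; simp }
  have hc : Function.Injective c := fun a b h => by
    ext j
    exact Nat.cast_injective (R := ℤ) (congrFun h j)
  refine ⟨AddMonoidAlgebra.mapDomainAlgHom k k c, AddMonoidAlgebra.mapDomain_injective hc,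
    fun j => ?_⟩
  change AddMonoidAlgebra.mapDomain c (AddMonoidAlgebra.single _ _) = _
  rw [AddMonoidAlgebra.mapDomain_single, yMon]
  congr 1
  ext l
  simp [c, Finsupp.single_apply, Pi.single_apply, eq_comm]

/-- The map factors as `k[x, y] ≅ k[y][x] → A[x]`, the second arrow being the injection `k[y] → A`
on coefficients. -/
theorem toLaurent_injective : Function.Injective (toLaurent k p m) := by
  obtain ⟨ψ, hψ, hX⟩ := exists_injective_algHom_laurent (k := k) (m := m)
  have h (f) : toLaurent k p m f = MvPolynomial.map (ψ : MvPolynomial (Fin m) k →+* Laurent k m)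
      (sumAlgEquiv k (Fin p) (Fin m) f) := by
    induction f using MvPolynomial.induction_on with
    | C a =>
      rw [sumAlgEquiv_C_inl, map_C, ← MvPolynomial.algebraMap_eq, AlgHom.commutes,
        RingHom.coe_coe, show ψ (C a) = algebraMap k _ a from ψ.commutes a,
        MvPolynomial.algebraMap_apply]
    | add a b ha hb => rw [map_add, ha, hb, map_add, map_add]
    | mul_X a i ha =>
      rw [map_mul, ha, map_mul, map_mul, toLaurent, aeval_X]
      rcases i with i | j
      · rw [Sum.elim_inl, sumAlgEquiv_X_inl, map_X]
      · rw [Sum.elim_inr, sumAlgEquiv_X_inr, map_C, RingHom.coe_coe, hX]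
  intro f g hfg
  rw [h, h] at hfg
  exact (sumAlgEquiv k (Fin p) (Fin m)).injective (MvPolynomial.map_injective _ hψ hfg)

theorem exists_yPow_mul_eq (f : MvPolynomial (Fin p) (Laurent k m)) :
    ∃ (n : Fin m → ℕ) (g : MvPolynomial (Fin p ⊕ Fin m) k),
      toLaurent k p m (yPow k p n) * f = toLaurent k p m g := by
  induction f using MvPolynomial.induction_on with
  | C a =>
    induction a using AddMonoidAlgebra.induction_linear with
    | zero => exact ⟨0, 0, by simp⟩
    | add a b ha hb =>
      obtain ⟨n, g, h⟩ := ha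
      obtain ⟨n', g', h'⟩ := hb
      refine ⟨n + n', yPow k p n' * g + yPow k p n * g', ?_⟩
      rw [C_add, map_add, map_mul, map_mul, ← h, ← h', yPow_add, map_mul]
      ring
    | single γ r =>
      refine ⟨fun j => (-γ j).toNat, C r * yPow k p fun j => (γ j).toNat, ?_⟩
      have h1 : AddMonoidAlgebra.single γ r = algebraMap k (Laurent k m) r * yMon k γ := by
        rw [← Algebra.smul_def, yMon, AddMonoidAlgebra.smul_single, smul_eq_mul, mul_one]
      have h2 : (fun j => ((-γ j).toNat : ℤ)) + γ = fun j => ((γ j).toNat : ℤ) := by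
        ext j
        simp only [Pi.add_apply]
        omega
      have h3 : toLaurent k p m (C r) = C (algebraMap k (Laurent k m) r) := by
        simp [toLaurent, MvPolynomial.algebraMap_apply]
      rw [map_mul, toLaurent_yPow, toLaurent_yPow, h3, h1, ← C_mul, ← C_mul, ← h2, yMon_add]
      ring_nf
  | add a b ha hb =>
    obtain ⟨n, g, h⟩ := ha
    obtain ⟨n', g', h'⟩ := hb
    refine ⟨n + n', yPow k p n' * g + yPow k p n * g', ?_⟩
    rw [map_add, map_mul, map_mul, ← h, ← h', yPow_add, map_mul]
    ring
  | mul_X a i ha =>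
    obtain ⟨n, g, h⟩ := ha
    refine ⟨n, g * X (Sum.inl i), ?_⟩
    rw [map_mul, ← h, ← mul_assoc]
    simp [toLaurent]

variable {I : Ideal (MvPolynomial (Fin p ⊕ Fin m) k)}

/-- Clearing denominators: `A[x]` arises from `k[x, y]` by inverting the `y_j`. -/
theorem exists_yPow_mul_eq_of_mem_extIdeal {f : MvPolynomial (Fin p) (Laurent k m)}
    (hf : f ∈ extIdeal I) : ∃ (n : Fin m → ℕ), ∃ g ∈ I,
      toLaurent k p m (yPow k p n) * f = toLaurent k p m g := by
  induction hf using Submodule.span_induction with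
  | mem f hf =>
    obtain ⟨g, hg, rfl⟩ := hf
    exact ⟨0, g, hg, by simp [yPow]⟩
  | zero => exact ⟨0, 0, I.zero_mem, by simp⟩
  | add a b _ _ ha hb =>
    obtain ⟨n, g, hg, h⟩ := ha
    obtain ⟨n', g', hg', h'⟩ := hb
    refine ⟨n + n', yPow k p n' * g + yPow k p n * g',
      I.add_mem (I.mul_mem_left _ hg) (I.mul_mem_left _ hg'), ?_⟩
    rw [map_add, map_mul, map_mul, ← h, ← h', yPow_add, map_mul]
    ring
  | smul a b _ hb =>
    obtain ⟨n, g, hg, h⟩ := hb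
    obtain ⟨n', g', h'⟩ := exists_yPow_mul_eq a
    refine ⟨n + n', g' * g, I.mul_mem_left _ hg, ?_⟩
    rw [map_mul, ← h, ← h', yPow_add, map_mul, smul_eq_mul]
    ring

theorem mem_of_yPow_mul_mem (hI : ∀ i f, X i * f ∈ I → f ∈ I) (n : Fin m → ℕ)
    {f : MvPolynomial (Fin p ⊕ Fin m) k} (h : yPow k p n * f ∈ I) : f ∈ I := by
  have key : ∀ (s : Finset (Fin m)) (f : MvPolynomial (Fin p ⊕ Fin m) k),
      (∏ j ∈ s, X (Sum.inr j) ^ n j) * f ∈ I → f ∈ I := by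
    intro s
    induction s using Finset.induction_on with
    | empty => intro f h; simpa using h
    | insert a s ha ih =>
      intro f h
      rw [Finset.prod_insert ha, mul_assoc] at h
      refine ih f ?_
      generalize n a = e at h
      induction e with
      | zero => simpa using h
      | succ e he =>
        refine he (hI (Sum.inr a) _ ?_)
        rwa [← mul_assoc, ← pow_succ']
  exact key _ f h

/-- Inverting the `y_j` adds nothing to `I`, since they are not zero divisors modulo `I`. -/
theorem toLaurent_mem_extIdeal_iff (hI : ∀ i f, X i * f ∈ I → f ∈ I)
    {g : MvPolynomial (Fin p ⊕ Fin m) k} : toLaurent k p m g ∈ extIdeal I ↔ g ∈ I := by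
  refine ⟨fun h => ?_, fun h => Ideal.mem_map_of_mem _ h⟩
  obtain ⟨n, g', hg', h⟩ := exists_yPow_mul_eq_of_mem_extIdeal h
  rw [← map_mul] at h
  refine mem_of_yPow_mul_mem hI n ?_
  rwa [toLaurent_injective h]

/-- The variables `x_i` are not zero divisors modulo the extended ideal. -/
theorem extIdeal_saturated (hI : ∀ i f, X i * f ∈ I → f ∈ I) (i : Fin p)
    (f : MvPolynomial (Fin p) (Laurent k m)) (h : X i * f ∈ extIdeal I) : f ∈ extIdeal I := by
  obtain ⟨n, g, hg⟩ := exists_yPow_mul_eq f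
  have h1 : toLaurent k p m (X (Sum.inl i) * g) ∈ extIdeal I := by
    have h2 : toLaurent k p m (X (Sum.inl i) * g) =
        toLaurent k p m (yPow k p n) * (X i * f) := by
      rw [map_mul, ← hg, toLaurent, aeval_X, Sum.elim_inl]
      ring
    rw [h2]
    exact Ideal.mul_mem_left _ _ h
  have h3 := hI _ _ ((toLaurent_mem_extIdeal_iff hI).1 h1)
  rw [← toLaurent_mem_extIdeal_iff hI, ← hg] at h3
  exact (Ideal.unit_mul_mem_iff_mem _ (isUnit_toLaurent_yPow n)).1 h3

theorem toLaurent_prod (a : Fin p ⊕ Fin m → ℕ) : toLaurent k p m (∏ i, X i ^ a i) =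
    monomial (Finsupp.equivFunOnFinite.symm fun i => a (Sum.inl i))
      (yMon k fun j => (a (Sum.inr j) : ℤ)) := by
  rw [Fintype.prod_sum_type, map_mul]
  have h := toLaurent_yPow (k := k) (p := p) fun j => a (Sum.inr j)
  rw [yPow] at h
  rw [h, monomial_eq, mul_comm]
  congr 1
  rw [Finsupp.prod_fintype _ _ (by simp)]
  simp [toLaurent]

/-- The extended ideal is generated by differences of Laurent monomials. -/
theorem extIdeal_eq_span (hI : IsBinomialIdeal I) :
    ∃ S : Set (MvPolynomial (Fin p) (Laurent k m)), extIdeal I = Ideal.span S ∧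
      ∀ f ∈ S, ∃ (a b : Fin p →₀ ℕ) (c d : Fin m → ℤ),
        f = monomial a (yMon k c) - monomial b (yMon k d) := by
  obtain ⟨S, hS⟩ := hI.generated
  refine ⟨_, by rw [extIdeal, hS, Ideal.map_span], ?_⟩
  rintro _ ⟨_, ⟨γ, -, rfl⟩, rfl⟩
  have h1 := toLaurent_prod (k := k) fun i => (γ i).toNat
  have h2 := toLaurent_prod (k := k) fun i => (-γ i).toNat
  exact ⟨_, _, _, _, (map_sub _ _ _).trans (congrArg₂ _ h1 h2)⟩

/-- The extended ideal vanishes at a point of `{0} × 𝕋^m`. -/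
theorem MeetsZeroTorus.exists_eval (h0 : MeetsZeroTorus I) :
    ∃ φ : MvPolynomial (Fin p) (Laurent k m) →+* AlgebraicClosure k,
      (∀ f ∈ extIdeal I, φ f = 0) ∧ ∀ i, φ (X i) = 0 := by
  obtain ⟨t, ht, hI⟩ := h0
  let v : Multiplicative (Fin m → ℤ) →* AlgebraicClosure k :=
    { toFun := fun γ => ∏ j, t j ^ (Multiplicative.toAdd γ j)
      map_one' := by simp
      map_mul' := fun a b => by
        rw [← Finset.prod_mul_distrib]
        exact Finset.prod_congr rfl fun j _ => zpow_add₀ (ht j) _ _ }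
  let w : Laurent k m →ₐ[k] AlgebraicClosure k := AddMonoidAlgebra.lift k _ _ v
  have hw : ∀ j, w (yMon k (Pi.single j 1)) = t j := fun j => by
    simp only [w, yMon, AddMonoidAlgebra.lift_single, one_smul]
    change ∏ l, t l ^ ((Pi.single j 1 : Fin m → ℤ) l) = t j
    rw [Finset.prod_eq_single j]
    · simp
    · intro l _ hl
      simp [hl]
    · simp
  obtain ⟨φ, hC, hX⟩ : ∃ φ : MvPolynomial (Fin p) (Laurent k m) →+* AlgebraicClosure k,
      (∀ a, φ (C a) = w a) ∧ ∀ i, φ (X i) = 0 :=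
    ⟨eval₂Hom (w : Laurent k m →+* AlgebraicClosure k) 0, fun a => eval₂Hom_C _ _ a,
      fun i => eval₂Hom_X' _ _ i⟩
  have hφ : ∀ f, φ (toLaurent k p m f) =
      aeval (Sum.elim (fun _ : Fin p => (0 : AlgebraicClosure k)) t) f := by
    intro f
    induction f using MvPolynomial.induction_on with
    | C a =>
      rw [← MvPolynomial.algebraMap_eq, AlgHom.commutes, AlgHom.commutes,
        MvPolynomial.algebraMap_apply, hC, AlgHom.commutes]
    | add a b ha hb => simp only [map_add, ha, hb]
    | mul_X a i ha =>
      rw [map_mul, map_mul, ha, map_mul, toLaurent, aeval_X, aeval_X]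
      rcases i with i | j
      · rw [Sum.elim_inl, Sum.elim_inl, hX]
      · rw [Sum.elim_inr, Sum.elim_inr, hC, hw]
  refine ⟨φ, fun f hf => ?_, hX⟩
  have : extIdeal I ≤ RingHom.ker φ := by
    refine Ideal.map_le_iff_le_comap.2 fun g hg => ?_
    rw [Ideal.mem_comap, RingHom.mem_ker]
    exact (hφ g).trans (hI g hg)
  exact this hf

theorem MeetsZeroTorus.one_notMem (h0 : MeetsZeroTorus I) :
    (1 : MvPolynomial _ _) ∉ extIdeal I := by
  obtain ⟨φ, hφ, -⟩ := h0.exists_eval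
  intro h
  simpa using hφ 1 h

/-- At a point with `x = 0`, the binomial `1 - x^ε y^γ` has value 1 unless `ε = 0`. -/
theorem MeetsZeroTorus.eq_zero_of_binom_mem (h0 : MeetsZeroTorus I) {ε : Fin p →₀ ℕ}
    {γ : Fin m → ℤ} (h : binom k 0 ε γ ∈ extIdeal I) : ε = 0 := by
  obtain ⟨φ, hφ, hX⟩ := h0.exists_eval
  by_contra hε
  obtain ⟨i, hi⟩ := Finsupp.ne_iff.1 hε
  have h1 := hφ _ h
  have h2 : monomial ε (yMon k γ) = monomial (ε - Finsupp.single i 1) (yMon k γ) * X i := by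
    rw [X, monomial_mul, mul_one, tsub_add_cancel_of_le]
    exact Finsupp.single_le_iff.2 (Nat.one_le_iff_ne_zero.2 hi)
  rw [binom, h2, map_sub, map_mul, hX, mul_zero, sub_zero] at h1
  exact one_ne_zero ((map_one φ).symm.trans h1)

end Extension

/-! ### Normal forms modulo the extended ideal -/

section NormalForms

variable {k : Type*} [Field k] {p m : ℕ} (I : Ideal (MvPolynomial (Fin p ⊕ Fin m) k))

/-- The exponents `δ` such that `x^δ` is congruent modulo the extended ideal to a Laurent monomial
`x^δ' y^γ` with `δ < δ'`. -/
def reducible : Set (Fin p →₀ ℕ) :=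
  {δ | ∃ (δ' : Fin p →₀ ℕ) (γ : Fin m → ℤ),
    toDegLex δ < toDegLex δ' ∧ binom k δ δ' γ ∈ extIdeal I}

variable {I}

theorem yIdeal_le_comap : yIdeal I ≤ (extIdeal I).comap C := by
  refine Ideal.span_le.2 ?_
  rintro _ ⟨γ, -, h⟩
  exact h

theorem yIdealExt_le : yIdealExt I ≤ extIdeal I :=
  Ideal.map_le_iff_le_comap.2 yIdeal_le_comap

theorem nontrivial_quotient (h0 : MeetsZeroTorus I) : Nontrivial (Laurent k m ⧸ yIdeal I) := by
  refine Ideal.Quotient.nontrivial_iff.2 fun h => h0.one_notMem ?_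
  have : (1 : Laurent k m) ∈ (extIdeal I).comap C := yIdeal_le_comap (h ▸ Submodule.mem_top)
  simpa using this

theorem one_sub_yMon_mem (hI : IsBinomialIdeal I) {δ : Fin p →₀ ℕ} {γ : Fin m → ℤ}
    (h : binom k δ δ γ ∈ extIdeal I) : 1 - yMon k γ ∈ yIdeal I := by
  refine Ideal.subset_span ⟨γ, rfl, ?_⟩
  rw [← binom_zero_zero]
  refine binom_mem_cancel (extIdeal_saturated hI.saturated) (ε := δ) ?_
  rwa [add_zero]

/-- Replacing exponents by larger ones congruent modulo `I` terminates. -/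
theorem wellFounded_reduction (hI : IsBinomialIdeal I) (h0 : MeetsZeroTorus I) :
    WellFounded fun δ' δ : Fin p →₀ ℕ =>
      toDegLex δ < toDegLex δ' ∧ ∃ γ : Fin m → ℤ, binom k δ δ' γ ∈ extIdeal I := by
  rw [wellFounded_iff_isEmpty_descending_chain]
  refine ⟨fun ⟨f, hf⟩ => ?_⟩
  have key : ∀ a b, a < b → toDegLex (f a) < toDegLex (f b) ∧
      ∃ γ : Fin m → ℤ, binom k (f a) (f b) γ ∈ extIdeal I := by
    intro a b hab
    induction b, hab using Nat.le_induction with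
    | base => exact hf a
    | succ b _ ih =>
      obtain ⟨h1, γ, h2⟩ := ih
      obtain ⟨h3, γ', h4⟩ := hf b
      exact ⟨h1.trans h3, _, binom_mem_trans h2 h4⟩
  -- Dickson's lemma; cancelling `x^(f a)` below forces `f b = f a`, against the strict increase.
  obtain ⟨a, b, hab, hle⟩ := wellQuasiOrdered_le f
  obtain ⟨h1, γ, h2⟩ := key a b hab
  obtain ⟨ε, hε⟩ := exists_add_of_le hle
  rw [hε] at h1 h2
  rw [← add_zero (f a), add_assoc, zero_add] at h2
  have h3 := h0.eq_zero_of_binom_mem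
    (binom_mem_cancel (extIdeal_saturated hI.saturated) h2)
  rw [h3, add_zero] at h1
  exact h1.false

theorem exists_normalForm (hI : IsBinomialIdeal I) (h0 : MeetsZeroTorus I) (δ : Fin p →₀ ℕ) :
    ∃ (δ' : Fin p →₀ ℕ) (γ : Fin m → ℤ),
      binom k δ δ' γ ∈ extIdeal I ∧ δ' ∉ reducible I ∧ toDegLex δ ≤ toDegLex δ' := by
  induction δ using (wellFounded_reduction hI h0).induction with
  | _ δ ih =>
    by_cases h : δ ∈ reducible I
    · obtain ⟨δ', γ, hlt, hmem⟩ := h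
      obtain ⟨δ'', γ', h1, h2, h3⟩ := ih δ' ⟨hlt, γ, hmem⟩
      exact ⟨δ'', _, binom_mem_trans hmem h1, h2, hlt.le.trans h3⟩
    · exact ⟨δ, 0, by simp, h, le_rfl⟩

/-- Otherwise the congruence, or its inverse, would reduce the smaller exponent to the larger. -/
theorem eq_of_binom_mem {δ δ' : Fin p →₀ ℕ} {γ : Fin m → ℤ} (hδ : δ ∉ reducible I)
    (hδ' : δ' ∉ reducible I) (h : binom k δ δ' γ ∈ extIdeal I) : δ = δ' := by
  rcases lt_trichotomy (toDegLex δ) (toDegLex δ') with h1 | h1 | h1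
  · exact absurd ⟨_, _, h1, h⟩ hδ
  · exact toDegLex.injective h1
  · exact absurd ⟨_, _, h1, binom_mem_symm h⟩ hδ'

theorem mk_yMon_eq (hI : IsBinomialIdeal I) {δ : Fin p →₀ ℕ} {γ γ' : Fin m → ℤ}
    (h : binom k δ δ (γ - γ') ∈ extIdeal I) :
    Ideal.Quotient.mk (yIdeal I) (yMon k γ) = Ideal.Quotient.mk (yIdeal I) (yMon k γ') := by
  have h1 := (yIdeal I).mul_mem_left (yMon k γ') (one_sub_yMon_mem hI h)
  rw [mul_sub, mul_one, ← yMon_add, add_sub_cancel] at h1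
  exact (Ideal.Quotient.eq.2 h1).symm

/-- An `A`-linear map to `B[x]`, which kills the extended ideal and takes each `x^δ` to a normal
form. -/
theorem exists_normalFormMap (hI : IsBinomialIdeal I) (h0 : MeetsZeroTorus I) :
    ∃ (nf : (Fin p →₀ ℕ) → (Fin p →₀ ℕ)) (u : (Fin p →₀ ℕ) → Laurent k m ⧸ yIdeal I)
      (φ : MvPolynomial (Fin p) (Laurent k m) →+ MvPolynomial (Fin p) (Laurent k m ⧸ yIdeal I)),
      (∀ δ a, φ (monomial δ a) = monomial (nf δ) (Ideal.Quotient.mk _ a * u δ)) ∧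
      (∀ δ ∉ reducible I, nf δ = δ ∧ u δ = 1) ∧ (∀ δ, toDegLex δ ≤ toDegLex (nf δ)) ∧
      ∀ f ∈ extIdeal I, φ f = 0 := by
  choose nf γ hmem hnf hle using exists_normalForm hI h0
  let b := basisMonomials (Fin p) (Laurent k m)
  let φ : MvPolynomial (Fin p) (Laurent k m) →ₗ[Laurent k m]
      MvPolynomial (Fin p) (Laurent k m ⧸ yIdeal I) :=
    -- The factor `y^(γ δ)` depends on choices in `A`, but its class in `B` does not.
    b.constr (Laurent k m) fun δ => monomial (nf δ) (Ideal.Quotient.mk _ (yMon k (γ δ)))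
  have hφ : ∀ δ a, φ (monomial δ a) =
      monomial (nf δ) (Ideal.Quotient.mk (yIdeal I) a *
        Ideal.Quotient.mk (yIdeal I) (yMon k (γ δ))) := by
    intro δ a
    have h1 : monomial δ a = a • b δ := by
      rw [show b δ = monomial δ 1 from congrFun (coe_basisMonomials _ _) δ, smul_monomial,
        smul_eq_mul, mul_one]
    rw [h1, map_smul, Module.Basis.constr_basis, smul_monomial, ← map_mul]
    rfl
  refine ⟨nf, _, φ.toAddMonoidHom, hφ, fun δ hδ => ?_, hle, fun f hf => ?_⟩
  · have h1 := eq_of_binom_mem hδ (hnf δ) (hmem δ)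
    refine ⟨h1.symm, ?_⟩
    have h2 := hmem δ
    rw [← h1] at h2
    rw [← map_one (Ideal.Quotient.mk (yIdeal I)), ← yMon_zero]
    exact mk_yMon_eq hI (δ := δ) (by rwa [sub_zero])
  · change φ f = 0
    obtain ⟨S, hS, hgen⟩ := extIdeal_eq_span hI
    have hSI : ∀ x ∈ S, x ∈ extIdeal I := fun x hx => hS ▸ Ideal.subset_span hx
    rw [hS] at hf
    induction hf using Submodule.closure_induction with
    | zero => exact map_zero _
    | add x y _ _ hx hy => rw [map_add, hx, hy, add_zero]
    | smul_mem r x hx =>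
      obtain ⟨a, b, c, d, rfl⟩ := hgen x hx
      -- Dividing the generator by the unit `y^c` turns it into a congruence `x^a ≡ x^b y^(d - c)`.
      have h1 : binom k a b (d - c) ∈ extIdeal I := by
        have h2 := (extIdeal I).mul_mem_left (C (yMon k (-c))) (hSI _ hx)
        rw [mul_sub, C_mul_monomial, C_mul_monomial, yMon_neg_mul, ← yMon_add,
          neg_add_eq_sub] at h2
        exact h2
      rw [smul_eq_mul]
      induction r using MvPolynomial.induction_on' with
      | monomial w e =>
        -- Chain from the normal form of `x^(w + a)` through `x^(w + a)` and `x^(w + b)` to the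
        -- normal form of `x^(w + b)`: the exponents agree, and the coefficients agree in `B`.
        have h2 := binom_mem_trans (binom_mem_symm (hmem (w + a)))
          (binom_mem_trans (binom_mem_add w h1) (hmem (w + b)))
        have h3 := eq_of_binom_mem (hnf _) (hnf _) h2
        rw [← h3] at h2
        have h4 : Ideal.Quotient.mk (yIdeal I) (yMon k (d + γ (w + b))) =
            Ideal.Quotient.mk (yIdeal I) (yMon k (c + γ (w + a))) :=
          mk_yMon_eq hI (δ := nf (w + a)) (by convert h2 using 2; abel)
        have h5 : ∀ v v', Ideal.Quotient.mk (yIdeal I) (e * yMon k v) *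
            Ideal.Quotient.mk (yIdeal I) (yMon k v') =
              Ideal.Quotient.mk (yIdeal I) e * Ideal.Quotient.mk (yIdeal I) (yMon k (v + v')) :=
          fun v v' => by rw [← map_mul, ← map_mul, mul_assoc, ← yMon_add]
        rw [mul_sub, monomial_mul, monomial_mul, map_sub, hφ, hφ, h5, h5, h4, h3, sub_self]
      | add x y hx hy => rw [add_mul, map_add, hx, hy, add_zero]

/-- If the coefficients below `α` of an element of the extended ideal lie in `J` and `α` is not
reducible, then the coefficient at `α` lies in `J`. -/
theorem coeff_mem_yIdeal (hI : IsBinomialIdeal I) (h0 : MeetsZeroTorus I)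
    {f : MvPolynomial (Fin p) (Laurent k m)} (hf : f ∈ extIdeal I) {α : Fin p →₀ ℕ}
    (hα : α ∉ reducible I) (hlt : ∀ β, toDegLex β < toDegLex α → coeff β f ∈ yIdeal I) :
    coeff α f ∈ yIdeal I := by
  obtain ⟨nf, u, φ, hφ, hnf, hle, hker⟩ := exists_normalFormMap hI h0
  have h1 := congrArg (coeff α) (hker f hf)
  -- Any other `δ` with `nf δ = α` satisfies `δ < α`, so its coefficient dies in `B`.
  rw [f.as_sum, map_sum, coeff_sum, coeff_zero, Finset.sum_eq_single α] at h1
  · rw [hφ, (hnf α hα).1, (hnf α hα).2, mul_one, coeff_monomial, if_pos rfl] at h1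
    exact Ideal.Quotient.eq_zero_iff_mem.1 h1
  · intro δ _ hδ
    rw [hφ, coeff_monomial]
    split_ifs with h2
    · have h3 : toDegLex δ < toDegLex α :=
        lt_of_le_of_ne (h2 ▸ hle δ) fun h => hδ (toDegLex.injective h)
      rw [Ideal.Quotient.eq_zero_iff_mem.2 (hlt δ h3), zero_mul]
    · rfl
  · intro h
    rw [notMem_support_iff.1 h, monomial_zero, map_zero, coeff_zero]

/-- An element of the extended ideal without reducible exponents lies in `J · A[x]`. -/
theorem mem_yIdealExt (hI : IsBinomialIdeal I) (h0 : MeetsZeroTorus I)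
    {f : MvPolynomial (Fin p) (Laurent k m)} (hf : f ∈ extIdeal I)
    (hs : ∀ δ ∈ f.support, δ ∉ reducible I) : f ∈ yIdealExt I := by
  rw [yIdealExt, mem_map_C_iff]
  have key : ∀ d : DegLex (Fin p →₀ ℕ), coeff (ofDegLex d) f ∈ yIdeal I := by
    intro d
    induction d using WellFoundedLT.induction with
    | ind d ih =>
      by_cases hd : ofDegLex d ∈ f.support
      · exact coeff_mem_yIdeal hI h0 hf (hs _ hd) fun β hβ => ih (toDegLex β) hβ
      · rw [notMem_support_iff.1 hd]
        exact zero_mem _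
  exact fun δ => key (toDegLex δ)

theorem coeff_modJ (f : MvPolynomial (Fin p) (Laurent k m)) (δ : Fin p →₀ ℕ) :
    coeff δ (modJ I f) = Ideal.Quotient.mk (yIdeal I) (coeff δ f) :=
  coeff_map _ _ _

/-- The point of `V(I)` gives `B ≠ 0`, so the coefficient 1 of `x^α` survives and the condition on
`exp` is automatic. -/
theorem represents_of_mem (h0 : MeetsZeroTorus I) {α β : Fin p →₀ ℕ} {γ : Fin m → ℤ}
    (hmem : binom k α β γ ∈ extIdeal I) (hlt : toDegLex α < toDegLex β) :
    Represents I α β γ := by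
  have := nontrivial_quotient h0
  have hne : β ≠ α := fun h => (h ▸ hlt).false
  refine ⟨hmem, hlt, ?_, fun δ hδ => ?_⟩
  · rw [coeff_coe, coeff_modJ, binom, coeff_sub, coeff_monomial, coeff_monomial, if_pos rfl,
      if_neg hne, sub_zero, map_one]
    exact one_ne_zero
  · by_contra! h
    refine hδ ?_
    rw [coeff_coe, coeff_modJ, binom, coeff_sub, coeff_monomial, coeff_monomial,
      if_neg fun e => (e ▸ h).false, if_neg fun e => ((e ▸ h).trans hlt).false, sub_zero, map_zero]

end NormalForms

/-! ### The diagram of initial exponents -/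

section Diagram

/-- An element of the ideal generated by polynomials agrees up to any given degree with a
polynomial of the ideal. -/
theorem exists_coeff_eq_of_mem_map {R : Type*} [CommRing R] {q : ℕ}
    {K : Ideal (MvPolynomial (Fin q) R)} {F : MvPowerSeries (Fin q) R}
    (hF : F ∈ K.map MvPolynomial.coeToMvPowerSeries.ringHom) (n : ℕ) :
    ∃ f ∈ K, ∀ δ, δ.degree < n → MvPowerSeries.coeff δ F = coeff δ f := by
  induction hF using Submodule.closure_induction with
  | zero => exact ⟨0, K.zero_mem, by simp⟩
  | add x y _ _ hx hy =>
    obtain ⟨f, hf, h⟩ := hx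
    obtain ⟨g, hg, h'⟩ := hy
    exact ⟨f + g, K.add_mem hf hg, fun δ hδ => by rw [map_add, h δ hδ, h' δ hδ, coeff_add]⟩
  | smul_mem r x hx =>
    obtain ⟨f, hf, rfl⟩ := hx
    -- Coefficients of a product in degree below `n` involve only those of `r` in degree below `n`.
    refine ⟨MvPowerSeries.truncTotal n r * f, K.mul_mem_left _ hf, fun δ hδ => ?_⟩
    rw [smul_eq_mul, MvPowerSeries.coeff_mul, MvPolynomial.coeff_mul]
    refine Finset.sum_congr rfl fun x hx => ?_
    rw [Finset.HasAntidiagonal.mem_antidiagonal] at hx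
    have : x.1.degree < n := by
      rw [← hx, map_add] at hδ
      omega
    rw [MvPowerSeries.coeff_truncTotal _ this]
    congr 1

variable {k : Type*} [Field k] {p m : ℕ} {I : Ideal (MvPolynomial (Fin p ⊕ Fin m) k)}

/-- An irreducible initial exponent would contradict `coeff_mem_yIdeal`; conversely, a reducing
binomial has the reducible exponent as its initial exponent. -/
theorem diagram_formalIdeal (hI : IsBinomialIdeal I) (h0 : MeetsZeroTorus I) :
    diagram (formalIdeal I) = reducible I := by
  ext α
  constructor
  · rintro ⟨F, hF, -, hne, hmin⟩
    by_contra hα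
    -- Every `β ≤ α` in `DegLex` has degree at most `|α|`, so this truncation sees all of them.
    obtain ⟨g, hg, hco⟩ := exists_coeff_eq_of_mem_map hF (α.degree + 1)
    obtain ⟨f, hf, rfl⟩ := (Ideal.mem_map_iff_of_surjective (modJ I)
      (map_surjective _ Ideal.Quotient.mk_surjective)).1 hg
    rw [hco α (Nat.lt_succ_self _), coeff_modJ] at hne
    refine hne (Ideal.Quotient.eq_zero_iff_mem.2 (coeff_mem_yIdeal hI h0 hf hα fun β hβ => ?_))
    rw [← Ideal.Quotient.eq_zero_iff_mem, ← coeff_modJ, ← hco β ?_]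
    · by_contra h
      exact (hmin β h).not_gt hβ
    · exact Nat.lt_succ_of_le (Finsupp.DegLex.monotone_degree hβ.le)
  · rintro ⟨β, γ, hlt, hmem⟩
    have h := represents_of_mem h0 hmem hlt
    refine ⟨_, Ideal.mem_map_of_mem _ (Ideal.mem_map_of_mem _ hmem), fun h1 => h.exp.1 ?_, h.exp⟩
    exact (congrArg _ h1).trans (map_zero _)

end Diagram

/-! ### Division and standard binomials -/

section Division

theorem mem_Δ_unique {q s : ℕ} {α : Fin s → Fin q →₀ ℕ} {i j : Fin s} {δ : Fin q →₀ ℕ}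
    (hi : δ ∈ Δ α i) (hj : δ ∈ Δ α j) : i = j := by
  rcases lt_trichotomy i j with h | h | h
  · exact absurd hi.1 (hj.2 i h)
  · exact h
  · exact absurd hj.1 (hi.2 j h)

theorem not_le_of_mem_Δ₀ {q s : ℕ} {α : Fin s → Fin q →₀ ℕ} {δ : Fin q →₀ ℕ}
    (hδ : δ ∈ Δ₀ α) (i : Fin s) : ¬ α i ≤ δ := by
  induction i using WellFoundedLT.induction with
  | ind i ih => exact fun h => hδ i ⟨h, fun j hj => ih j hj⟩

namespace IsDivision

variable {A : Type*} [CommRing A] {q s : ℕ} {α : Fin s → Fin q →₀ ℕ}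
  {G : Fin s → MvPolynomial (Fin q) A} {F F' : MvPolynomial (Fin q) A}
  {Q Q' : Fin s → MvPolynomial (Fin q) A} {R R' : MvPolynomial (Fin q) A}

theorem add (h : IsDivision α G F Q R) (h' : IsDivision α G F' Q' R') :
    IsDivision α G (F + F') (Q + Q') (R + R') := by
  classical
  refine ⟨fun i ε hε => ?_, fun δ hδ => ?_, ?_⟩
  · rcases Finset.mem_union.1 (support_add hε) with h1 | h1
    · exact h.supp_quotient i ε h1
    · exact h'.supp_quotient i ε h1
  · rcases Finset.mem_union.1 (support_add hδ) with h1 | h1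
    · exact h.supp_remainder δ h1
    · exact h'.supp_remainder δ h1
  · simp only [Pi.add_apply, mul_add, Finset.sum_add_distrib]
    rw [h.eq, h'.eq]
    abel

theorem C_mul (a : A) (h : IsDivision α G F Q R) :
    IsDivision α G (C a * F) (fun i => C a * Q i) (C a * R) := by
  have hs : ∀ (f : MvPolynomial (Fin q) A) δ, δ ∈ (C a * f).support → δ ∈ f.support := by
    intro f δ hδ
    rw [mem_support_iff, coeff_C_mul] at hδ
    exact mem_support_iff.2 (right_ne_zero_of_mul hδ)
  refine ⟨fun i ε hε => h.supp_quotient i ε (hs _ _ hε),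
    fun δ hδ => h.supp_remainder δ (hs _ _ hδ), ?_⟩
  rw [h.eq, mul_add, Finset.mul_sum]
  congr 1
  exact Finset.sum_congr rfl fun i _ => by ring

/-- A division of zero is trivial, if each divisor is `x^α^i` minus a term of higher order. -/
theorem eq_zero {η : Fin s → Fin q →₀ ℕ} {u : Fin s → A}
    (hlt : ∀ i, toDegLex (α i) < toDegLex (η i))
    (h : IsDivision α (fun i => monomial (α i) 1 - monomial (η i) (u i)) 0 Q R) :
    Q = 0 ∧ R = 0 := by
  have key : ∀ d : DegLex (Fin q →₀ ℕ),
      (∀ i ε, α i + ε = ofDegLex d → coeff ε (Q i) = 0) ∧ coeff (ofDegLex d) R = 0 := by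
    intro d
    induction d using WellFoundedLT.induction with
    | ind d ih =>
      set δ := ofDegLex d
      have hd : d = toDegLex δ := rfl
      -- A contribution of `x^(η i) * Q i` at `δ` uses the coefficient of `Q i` attached to the
      -- smaller exponent `α i + (δ - η i)`, zero by induction. In what remains, disjointness of the
      -- `Δ` sets leaves at most one term.
      have h1 : ∑ i, coeff δ (monomial (α i) 1 * Q i) + coeff δ R = 0 := by
        have h2 := congrArg (coeff δ) h.eq
        rw [coeff_zero, coeff_add, coeff_sum] at h2
        rw [h2]
        congr 1
        refine Finset.sum_congr rfl fun i _ => ?_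
        rw [sub_mul, coeff_sub, coeff_monomial_mul' _ (η i)]
        split_ifs with h3
        · have h4 : toDegLex (α i + (δ - η i)) < d := by
            rw [hd]
            conv_rhs => rw [← add_tsub_cancel_of_le h3]
            rw [toDegLex_add, toDegLex_add]
            exact add_lt_add_left (hlt i) _
          rw [(ih _ h4).1 i _ rfl, mul_zero, sub_zero]
        · rw [sub_zero]
      have h2 : ∀ i, δ ∉ Δ α i → coeff δ (monomial (α i) 1 * Q i) = 0 := by
        intro i hi
        rw [coeff_monomial_mul']
        split_ifs with h3
        · rw [one_mul]
          by_contra h4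
          refine hi ?_
          have h5 := h.supp_quotient i _ (mem_support_iff.2 h4)
          rwa [add_tsub_cancel_of_le h3] at h5
        · rfl
      suffices h3 : (∀ i, coeff δ (monomial (α i) 1 * Q i) = 0) ∧ coeff δ R = 0 by
        refine ⟨fun i ε hε => ?_, h3.2⟩
        have h4 := h3.1 i
        rwa [← hε, coeff_monomial_mul, one_mul] at h4
      by_cases hδ : ∃ i, δ ∈ Δ α i
      · obtain ⟨i, hi⟩ := hδ
        have hR : coeff δ R = 0 := by
          by_contra h3
          exact h.supp_remainder δ (mem_support_iff.2 h3) i hi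
        have h3 : ∀ j, j ≠ i → coeff δ (monomial (α j) 1 * Q j) = 0 := fun j hj =>
          h2 j fun h4 => hj (mem_Δ_unique h4 hi)
        rw [hR, add_zero, Finset.sum_eq_single i (fun j _ hj => h3 j hj) (by simp)] at h1
        refine ⟨fun j => ?_, hR⟩
        by_cases hj : j = i
        · rwa [hj]
        · exact h3 j hj
      · push Not at hδ
        have h3 := fun i => h2 i (hδ i)
        rw [Finset.sum_eq_zero fun i _ => h3 i, zero_add] at h1
        exact ⟨h3, h1⟩
  refine ⟨funext fun i => ?_, ?_⟩
  · ext ε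
    exact (key (toDegLex (α i + ε))).1 i ε rfl
  · ext δ
    exact (key (toDegLex δ)).2

theorem unique {η : Fin s → Fin q →₀ ℕ} {u : Fin s → A}
    (hlt : ∀ i, toDegLex (α i) < toDegLex (η i))
    (h : IsDivision α (fun i => monomial (α i) 1 - monomial (η i) (u i)) F Q R)
    (h' : IsDivision α (fun i => monomial (α i) 1 - monomial (η i) (u i)) F Q' R') :
    Q = Q' ∧ R = R' := by
  have h1 := h.add (h'.C_mul (-1))
  rw [C_neg, C_1, neg_one_mul, neg_one_mul, add_neg_cancel] at h1
  obtain ⟨h2, h3⟩ := h1.eq_zero hlt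
  refine ⟨funext fun i => ?_, add_neg_eq_zero.1 h3⟩
  have h4 := congrFun h2 i
  rw [Pi.add_apply, neg_one_mul] at h4
  exact add_neg_eq_zero.1 h4

end IsDivision

variable {k : Type*} [Field k] {p m : ℕ} {I : Ideal (MvPolynomial (Fin p ⊕ Fin m) k)}

/-- The division of a monomial `x^δ` exists, and its remainder is a Laurent monomial. -/
theorem exists_isDivision_monomial (hI : IsBinomialIdeal I) (h0 : MeetsZeroTorus I) {s : ℕ}
    {α η : Fin s → Fin p →₀ ℕ} {ζ : Fin s → Fin m → ℤ}
    (hG : ∀ i, Represents I (α i) (η i) (ζ i)) (δ : Fin p →₀ ℕ) :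
    ∃ (Q : Fin s → MvPolynomial (Fin p) (Laurent k m)) (δ' : Fin p →₀ ℕ) (γ' : Fin m → ℤ),
      IsDivision α (fun i => binom k (α i) (η i) (ζ i)) (monomial δ 1) Q
        (monomial δ' (yMon k γ')) := by
  classical
  induction δ using (wellFounded_reduction hI h0).induction with
  | _ δ ih =>
    by_cases hδ : ∃ i, δ ∈ Δ α i
    · obtain ⟨i, hi⟩ := hδ
      obtain ⟨ε, hε⟩ := exists_add_of_le hi.1
      rw [add_comm] at hε
      -- One division step, `x^δ = G^i x^ε + y^(ζ i) x^(ε + η i)`, raises the exponent within its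
      -- congruence class.
      have hlt : toDegLex δ < toDegLex (ε + η i) := by
        rw [hε, toDegLex_add, toDegLex_add]
        exact add_lt_add_right (hG i).lt _
      obtain ⟨Q, δ', γ', h⟩ :=
        ih (ε + η i) ⟨hlt, ζ i, hε ▸ binom_mem_add ε (hG i).mem⟩
      have h1 : IsDivision α (fun i => binom k (α i) (η i) (ζ i))
          (binom k (α i) (η i) (ζ i) * monomial ε 1) (Pi.single i (monomial ε 1)) 0 := by
        refine ⟨fun j τ hτ => ?_, by simp, ?_⟩
        · by_cases hj : j = i
          · subst hj
            rw [Pi.single_eq_same] at hτ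
            have := Finset.mem_singleton.1 (support_monomial_subset hτ)
            rw [this, add_comm, ← hε]
            exact hi
          · simp [Pi.single_eq_of_ne hj] at hτ
        · rw [add_zero, Finset.sum_eq_single i, Pi.single_eq_same]
          · intro j _ hj
            rw [Pi.single_eq_of_ne hj, mul_zero]
          · simp
      have h2 := h1.add (h.C_mul (yMon k (ζ i)))
      have h3 : binom k (α i) (η i) (ζ i) * monomial ε 1 +
          C (yMon k (ζ i)) * monomial (ε + η i) 1 = monomial δ 1 := by
        rw [hε, binom, sub_mul, monomial_mul, monomial_mul, C_mul_monomial, mul_one, mul_one,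
          add_comm (α i), add_comm (η i), sub_add_cancel]
      rw [h3, zero_add, C_mul_monomial, ← yMon_add] at h2
      exact ⟨_, _, _, h2⟩
    · push Not at hδ
      refine ⟨0, δ, 0, by simp, fun τ hτ => ?_, by simp⟩
      rw [Finset.mem_singleton.1 (support_monomial_subset hτ)]
      exact hδ

theorem exists_isDivision (hI : IsBinomialIdeal I) (h0 : MeetsZeroTorus I) {s : ℕ}
    {α η : Fin s → Fin p →₀ ℕ} {ζ : Fin s → Fin m → ℤ}
    (hG : ∀ i, Represents I (α i) (η i) (ζ i)) (F : MvPolynomial (Fin p) (Laurent k m)) :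
    ∃ Q R, IsDivision α (fun i => binom k (α i) (η i) (ζ i)) F Q R := by
  induction F using MvPolynomial.induction_on' with
  | monomial δ a =>
    obtain ⟨Q, δ', γ', h⟩ := exists_isDivision_monomial hI h0 hG δ
    have h1 := h.C_mul a
    rw [C_mul_monomial, mul_one] at h1
    exact ⟨_, _, h1⟩
  | add f g hf hg =>
    obtain ⟨Q, R, h⟩ := hf
    obtain ⟨Q', R', h'⟩ := hg
    exact ⟨_, _, h.add h'⟩

/-- Take the normal form of `x^α`; it differs from `α` because `α` is reducible. -/
theorem exists_isStdBinomial (hI : IsBinomialIdeal I) (h0 : MeetsZeroTorus I) {α : Fin p →₀ ℕ}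
    (hα : α ∈ diagram (formalIdeal I)) :
    ∃ (β : Fin p →₀ ℕ) (γ : Fin m → ℤ), IsStdBinomial I α β γ := by
  rw [diagram_formalIdeal hI h0] at hα
  obtain ⟨β, γ, h1, h2, h3⟩ := exists_normalForm hI h0 α
  refine ⟨β, γ, h1, by rwa [diagram_formalIdeal hI h0], lt_of_le_of_ne h3 fun h => h2 ?_⟩
  rwa [← toDegLex.injective h]

/-- Both `β` and `β'` are irreducible and congruent, hence equal; the difference is supported at
this one irreducible exponent, so `mem_yIdealExt` applies. -/
theorem IsStdBinomial.unique (hI : IsBinomialIdeal I) (h0 : MeetsZeroTorus I)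
    {α β β' : Fin p →₀ ℕ} {γ γ' : Fin m → ℤ} (h : IsStdBinomial I α β γ)
    (h' : IsStdBinomial I α β' γ') :
    β' = β ∧ binom k α β' γ' - binom k α β γ ∈ yIdealExt I := by
  have hβ := h.notMem_diagram
  have hβ' := h'.notMem_diagram
  rw [diagram_formalIdeal hI h0] at hβ hβ'
  obtain rfl : β' = β :=
    eq_of_binom_mem hβ' hβ (binom_mem_trans (binom_mem_symm h'.mem) h.mem)
  refine ⟨rfl, mem_yIdealExt hI h0 ((extIdeal I).sub_mem h'.mem h.mem) fun δ hδ => ?_⟩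
  have h1 : binom k α β' γ' - binom k α β' γ = monomial β' (yMon k γ - yMon k γ') := by
    rw [binom, binom, sub_sub_sub_cancel_left, map_sub]
  rw [h1] at hδ
  rwa [Finset.mem_singleton.1 (support_monomial_subset hδ)]

/-- A reducible exponent lies in the diagram, hence above one of its vertices. -/
theorem notMem_reducible_of_mem_Δ₀ (hI : IsBinomialIdeal I) (h0 : MeetsZeroTorus I) {s : ℕ}
    {α : Fin s → Fin p →₀ ℕ} (hvert : Set.range α = vertices (diagram (formalIdeal I)))
    {δ : Fin p →₀ ℕ} (hδ : δ ∈ Δ₀ α) : δ ∉ reducible I := by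
  intro h
  rw [← diagram_formalIdeal hI h0] at h
  obtain ⟨v, hv, hm⟩ := exists_minimal_le_of_wellFoundedLT (· ∈ diagram (formalIdeal I)) δ h
  obtain ⟨i, rfl⟩ : v ∈ Set.range α := hvert ▸ hm
  exact not_le_of_mem_Δ₀ hδ i hv

theorem extIdeal_eq_span_sup (hI : IsBinomialIdeal I) (h0 : MeetsZeroTorus I) {s : ℕ}
    {α β : Fin s → Fin p →₀ ℕ} {γ : Fin s → Fin m → ℤ}
    (hvert : Set.range α = vertices (diagram (formalIdeal I)))
    (hF : ∀ i, Represents I (α i) (β i) (γ i)) :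
    extIdeal I = Ideal.span (Set.range fun i => binom k (α i) (β i) (γ i)) ⊔ yIdealExt I := by
  refine le_antisymm (fun f hf => ?_) (sup_le (Ideal.span_le.2 ?_) yIdealExt_le)
  · obtain ⟨Q, R, h⟩ := exists_isDivision hI h0 hF f
    have h1 : ∑ i, binom k (α i) (β i) (γ i) * Q i ∈ extIdeal I :=
      Ideal.sum_mem _ fun i _ => Ideal.mul_mem_right _ _ (hF i).mem
    have hR : R ∈ extIdeal I := by
      rw [h.eq] at hf
      exact (Ideal.add_mem_iff_right _ h1).1 hf
    rw [h.eq]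
    refine Submodule.add_mem_sup (Ideal.sum_mem _ fun i _ =>
      Ideal.mul_mem_right _ _ (Ideal.subset_span ⟨i, rfl⟩)) (mem_yIdealExt hI h0 hR fun δ hδ => ?_)
    exact notMem_reducible_of_mem_Δ₀ hI h0 hvert (h.supp_remainder δ hδ)
  · rintro _ ⟨i, rfl⟩
    exact (hF i).mem

end Division

end BinomialStd

end

theorem theorem6p5 {k : Type*} [Field k] {p m : ℕ}
    (I : Ideal (MvPolynomial (Fin p ⊕ Fin m) k))
    (hI : BinomialStd.IsBinomialIdeal I) (h0 : BinomialStd.MeetsZeroTorus I)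
    -- `α^1, …, α^s` are the vertices of the diagram of initial exponents, in any order
    (s : ℕ) (α : Fin s → Fin p →₀ ℕ) (hα : Function.Injective α)
    (hvert : Set.range α = BinomialStd.vertices
      (BinomialStd.diagram (BinomialStd.formalIdeal I))) :
    -- the vertices are represented by binomials in `I`
    (∀ i, ∃ (η : Fin p →₀ ℕ) (ζ : Fin m → ℤ), BinomialStd.Represents I (α i) η ζ) ∧
    -- division by any choice of representing binomials `G^i`
    (∀ (η : Fin s → Fin p →₀ ℕ) (ζ : Fin s → Fin m → ℤ),
      (∀ i, BinomialStd.Represents I (α i) (η i) (ζ i)) →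
      -- existence and uniqueness of the division
      (∀ F : MvPolynomial (Fin p) (BinomialStd.Laurent k m),
        ∃! QR : (Fin s → MvPolynomial (Fin p) (BinomialStd.Laurent k m)) ×
            MvPolynomial (Fin p) (BinomialStd.Laurent k m),
          BinomialStd.IsDivision α (fun i => BinomialStd.binom k (α i) (η i) (ζ i))
            F QR.1 QR.2) ∧
      -- the remainder of `c x^δ y^γ` is `c x^δ' y^γ'`
      (∀ (c : k) (δ : Fin p →₀ ℕ) (γ : Fin m → ℤ)
        (Q : Fin s → MvPolynomial (Fin p) (BinomialStd.Laurent k m))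
        (R : MvPolynomial (Fin p) (BinomialStd.Laurent k m)),
        BinomialStd.IsDivision α (fun i => BinomialStd.binom k (α i) (η i) (ζ i))
          (MvPolynomial.monomial δ (c • BinomialStd.yMon k γ)) Q R →
        ∃ (δ' : Fin p →₀ ℕ) (γ' : Fin m → ℤ),
          R = MvPolynomial.monomial δ' (c • BinomialStd.yMon k γ'))) ∧
    -- for each `i` there is a binomial `F^i`, unique modulo `J · A[x]`
    (∀ i, ∃ (β : Fin p →₀ ℕ) (γ : Fin m → ℤ), BinomialStd.IsStdBinomial I (α i) β γ ∧
      ∀ (β' : Fin p →₀ ℕ) (γ' : Fin m → ℤ), BinomialStd.IsStdBinomial I (α i) β' γ' →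
        β' = β ∧ BinomialStd.binom k (α i) β' γ' - BinomialStd.binom k (α i) β γ ∈
          BinomialStd.yIdealExt I) ∧
    -- the `F^i` generate `I` modulo `J · A[x]`
    (∀ (β : Fin s → Fin p →₀ ℕ) (γ : Fin s → Fin m → ℤ),
      (∀ i, BinomialStd.IsStdBinomial I (α i) (β i) (γ i)) →
      BinomialStd.extIdeal I =
        Ideal.span (Set.range fun i => BinomialStd.binom k (α i) (β i) (γ i)) ⊔
          BinomialStd.yIdealExt I) := by
  have hmem : ∀ i, α i ∈ BinomialStd.diagram (BinomialStd.formalIdeal I) := fun i =>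
    (hvert ▸ Set.mem_range_self i : α i ∈ BinomialStd.vertices _).1
  refine ⟨fun i => ?_, fun η ζ hG => ⟨fun F => ?_, fun c δ γ Q R h => ?_⟩, fun i => ?_,
    fun β γ hF => BinomialStd.extIdeal_eq_span_sup hI h0 hvert fun i =>
      BinomialStd.represents_of_mem h0 (hF i).mem (hF i).lt⟩
  · obtain ⟨β, γ, h⟩ := BinomialStd.exists_isStdBinomial hI h0 (hmem i)
    exact ⟨β, γ, BinomialStd.represents_of_mem h0 h.mem h.lt⟩
  · obtain ⟨Q, R, h⟩ := BinomialStd.exists_isDivision hI h0 hG F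
    refine ⟨(Q, R), h, fun QR h' => ?_⟩
    obtain ⟨h1, h2⟩ := BinomialStd.IsDivision.unique (fun i => (hG i).lt) h' h
    exact Prod.ext h1 h2
  · obtain ⟨Q', δ', γ', h'⟩ := BinomialStd.exists_isDivision_monomial hI h0 hG δ
    -- Scaling the division of `x^δ` by `c y^γ` gives a division with monomial remainder; by
    -- uniqueness it is the given one.
    have h1 := h'.C_mul (c • BinomialStd.yMon k γ)
    rw [MvPolynomial.C_mul_monomial, MvPolynomial.C_mul_monomial, mul_one, smul_mul_assoc,
      ← BinomialStd.yMon_add] at h1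
    exact ⟨δ', γ + γ', (BinomialStd.IsDivision.unique (fun i => (hG i).lt) h h1).2⟩
  · obtain ⟨β, γ, h⟩ := BinomialStd.exists_isStdBinomial hI h0 (hmem i)
    exact ⟨β, γ, h, fun β' γ' h' => h.unique hI h0 h'⟩
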